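/- Let $M$ be a connected smooth manifold and $\omega\in\Omega^3(M)$ a 2-plectic form, i.e. $d\omega=0$ and $v\mapsto \iota_v\omega$ is injective on every tangent space. Let $\mathfrak g$ be a finite-dimensional real Lie algebra and $x\mapsto v_x$ a Lie algebra morphism $\mathfrak g\to\mathfrak X(M)$ such that every $v_x$ is Hamiltonian, i.e. $\iota_{v_x}\omega$ is exact. Let $L=\mathfrak h[1]\oplus\mathfrak g$ be a finite-dimensional minimal Lie 2-algebra (zero unary bracket) extending $\mathfrak g$, with brackets $[x,h]\in\mathfrak h$ and $[x,y,z]\in\mathfrak h$ for $x,y,z\in\mathfrak g$, $h\in\mathfrak h$. Write $\iota(u\wedge v)\omega=\iota_v\iota_u\omega$. Let $CE(L)$ be the Chevalley–Eilenberg complex of $L$, so that $CE(L)^1=\mathfrak g^*$, $CE(L)^2=\mathfrak h^*\oplus\wedge^2\mathfrak g^*$, $CE(L)^3=(\mathfrak g^*\otimes\mathfrak h^*)\oplus\wedge^3\mathfrak g^*$. The differential sends $\xi\in CE(L)^1$ to $(0,\,-\xi([x,y]))$, and $\eta\in CE(L)^2$ to the pair with components $-\eta([x,h])$ and $-\eta([x,y],z)+\eta([x,z],y)-\eta([y,z],x)-\eta([x,y,z])$.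 Let $C=CE(L)\otimes\Omega(M)$ be the total complex, so that $C^1=\mathfrak g^*\otimes C^\infty(M)$ and $C^2=\mathfrak g^*\otimes\Omega^1(M)\,\oplus\,(\mathfrak h^*\oplus\wedge^2\mathfrak g^*)\otimes C^\infty(M)$. For $\alpha\in C^1$, $d_{tot}\alpha\in C^2$ has components $-d(\alpha(x))$, $0$ and $-\alpha([x,y])$. Let $L_\infty(M,\omega)$ be the Lie 2-algebra of observables: $\Omega^1_{\rm Ham}(M)$ in degree $0$, $C^\infty(M)$ in degree $-1$, unary bracket $d$, binary and trinary brackets $\omega(v_\alpha,v_\beta,\cdot)$ and $-\omega(v_\alpha,v_\beta,v_\gamma)$ on degree $0$ elements (zero otherwise), where $d\alpha=-\iota_{v_\alpha}\omega$. A moment map for $L$ is an element $\mu=(\mu_1|_{\mathfrak g},\mu_1|_{\mathfrak h},\mu_2)\in C^2$ whose components form an $L_\infty$-morphism $L\to L_\infty(M,\omega)$ with $d(\mu_1(x))=-\iota_{v_x}\omega$ for all $x\in\mathfrak g$. Two moment maps $\mu,\mu'$ are inner equivalent if $\mu-\mu'=d_{tot}\alpha$ for some $\alpha\in C^1$. Assume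 $H^1(M)=0$. Fix $p\in M$ and a linear map $\gamma_1\colon\mathfrak g\to\Omega^1_{\rm Ham}(M)$ with $d\gamma_1(x)=-\iota_{v_x}\omega$ for all $x$. Let $r\colon C^2\to CE(L)^2$ evaluate the function components at $p$ and kill the $\Omega^1(M)$-component, and put $\omega_{3p}(x,y,z)=\omega(v_x,v_y,v_z)|_p$, regarded as an element of $CE(L)^3$. Then for every moment map $\mu\in C^2$ for $L$: 1. $r(\mu)$ is a primitive of $\omega_{3p}$: $d_{CE(L)}\,r(\mu)=\omega_{3p}$. 2. There is a unique $\gamma_2\colon\wedge^2\mathfrak g\to C^\infty(M)$ with $\gamma_1([x,y])-\iota(v_x\wedge v_y)\omega=d(\gamma_2(x,y))$ and $\gamma_2(x,y)(p)=0$ for all $x,y\in\mathfrak g$. 3. For $\eta\in CE(L)^2$ let $\phi^\eta\in C^2$ be given by $\phi^\eta_1(x)=\gamma_1(x)$, $\phi^\eta_1(h)=\eta(h)$ (a constant function), $\phi^\eta_2(x,y)=\eta(x,y)+\gamma_2(x,y)$. Then $\phi^{r(\mu)}$ is a moment map for $L$, and $\mu$ and $\phi^{r(\mu)}$ are inner equivalent: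 $\mu-\phi^{r(\mu)}=d_{tot}\alpha$ for some $\alpha\in C^1$. In particular, every moment map for $L$ is inner equivalent to $\phi^\eta$ for some $\eta\in CE(L)^2$ with $d_{CE(L)}\eta=\omega_{3p}$. -/

import Mathlib

open Set Filter Topology
open scoped Manifold ContDiff Bundle

noncomputable section

namespace MomentMap

section Forms

variable (E : Type*) [NormedAddCommGroup E] [NormedSpace ℝ E]
  (M : Type*) [TopologicalSpace M] [ChartedSpace E M]

/-- Not necessarily smooth (set-theoretic) differential `k`-forms on `M`. -/
def RawForm (k : ℕ) : Type _ := (x : M) → TangentSpace 𝓘(ℝ, E) x [⋀^Fin k]→L[ℝ] ℝ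

instance (k : ℕ) : AddCommGroup (RawForm E M k) :=
  inferInstanceAs (AddCommGroup ((x : M) → TangentSpace 𝓘(ℝ, E) x [⋀^Fin k]→L[ℝ] ℝ))

instance (k : ℕ) : Module ℝ (RawForm E M k) :=
  inferInstanceAs (Module ℝ ((x : M) → TangentSpace 𝓘(ℝ, E) x [⋀^Fin k]→L[ℝ] ℝ))

variable {E M}

/-- Coordinate expression of `ϖ` in the preferred chart at `x₀`: the pullback of `ϖ` along the
inverse of that chart. -/
def chartRep {k : ℕ} (ϖ : RawForm E M k) (x₀ : M) (y : E) : E [⋀^Fin k]→L[ℝ] ℝ :=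
  (ϖ ((extChartAt 𝓘(ℝ, E) x₀).symm y)).compContinuousLinearMap
    (mfderiv 𝓘(ℝ, E) 𝓘(ℝ, E) (extChartAt 𝓘(ℝ, E) x₀).symm y)

/-- A form is smooth when all its coordinate expressions are. -/
def IsSmoothForm {k : ℕ} (ϖ : RawForm E M k) : Prop :=
  ∀ x₀ : M, ContDiffOn ℝ ∞ (chartRep ϖ x₀) (extChartAt 𝓘(ℝ, E) x₀).target

variable (E M) in
/-- `Ω^k(M)`, the real vector space of smooth differential `k`-forms. -/
def Form (k : ℕ) : Submodule ℝ (RawForm E M k) where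
  carrier := {ϖ | IsSmoothForm ϖ}
  add_mem' := fun ha hb x₀ => (ha x₀).add (hb x₀)
  zero_mem' := fun _ => contDiffOn_const (c := (0 : E [⋀^Fin k]→L[ℝ] ℝ))
  smul_mem' := fun c _ ha x₀ => (ha x₀).const_smul c

/-- Exterior derivative, computed at `x` in the preferred chart at `x`. -/
def rawExtDeriv {k : ℕ} (ϖ : RawForm E M k) : RawForm E M (k + 1) := fun x =>
  (extDeriv (chartRep ϖ x) (extChartAt 𝓘(ℝ, E) x x)).compContinuousLinearMap
    (mfderiv 𝓘(ℝ, E) 𝓘(ℝ, E) (extChartAt 𝓘(ℝ, E) x) x)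

theorem IsSmoothForm.contDiffAt {k : ℕ} {ϖ : RawForm E M k} (hϖ : IsSmoothForm ϖ) (x₀ : M) {y : E}
    (hy : y ∈ (extChartAt 𝓘(ℝ, E) x₀).target) : ContDiffAt ℝ ∞ (chartRep ϖ x₀) y :=
  (hϖ x₀).contDiffAt ((isOpen_extChartAt_target x₀).mem_nhds hy)

theorem rawForm_pullback_congr {k : ℕ} (ϖ : RawForm E M k) {q q' : M} (h : q' = q)
    (A : E →L[ℝ] TangentSpace 𝓘(ℝ, E) q') (B : E →L[ℝ] TangentSpace 𝓘(ℝ, E) q)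
    (hAB : (A : E →L[ℝ] E) = (B : E →L[ℝ] E)) :
    (ϖ q').compContinuousLinearMap A = (ϖ q).compContinuousLinearMap B := by
  subst h
  exact congrArg _ hAB

/-- Contraction `ι_v φ = φ(v, ·, …, ·)` of an alternating form at a point. -/
def contractAt {k : ℕ} {x : M} (v : TangentSpace 𝓘(ℝ, E) x)
    (φ : TangentSpace 𝓘(ℝ, E) x [⋀^Fin (k + 1)]→L[ℝ] ℝ) :
    TangentSpace 𝓘(ℝ, E) x [⋀^Fin k]→L[ℝ] ℝ :=
  ContinuousAlternatingMap.curryLeft (𝕜 := ℝ) (E := E) φ v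

theorem contractAt_apply {k : ℕ} {x : M} (v : TangentSpace 𝓘(ℝ, E) x)
    (φ : TangentSpace 𝓘(ℝ, E) x [⋀^Fin (k + 1)]→L[ℝ] ℝ) (u : Fin k → TangentSpace 𝓘(ℝ, E) x) :
    contractAt v φ u = φ (Matrix.vecCons v u) := rfl

section
variable [IsManifold 𝓘(ℝ, E) ∞ M]

/-- The exterior derivative does not depend on the chart. -/
theorem chartRep_rawExtDeriv {k : ℕ} {ϖ : RawForm E M k} (hϖ : IsSmoothForm ϖ) (x₀ : M) {y : E}
    (hy : y ∈ (extChartAt 𝓘(ℝ, E) x₀).target) :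
    chartRep (rawExtDeriv ϖ) x₀ y = extDeriv (chartRep ϖ x₀) y := by
  have : IsManifold 𝓘(ℝ, E) 1 M := IsManifold.of_le (n := ∞) (by simp)
  set x := (extChartAt 𝓘(ℝ, E) x₀).symm y with hx
  set τ : E → E := extChartAt 𝓘(ℝ, E) x ∘ (extChartAt 𝓘(ℝ, E) x₀).symm with hτ
  set U : Set E := (extChartAt 𝓘(ℝ, E) x₀).target ∩
    (extChartAt 𝓘(ℝ, E) x₀).symm ⁻¹' (extChartAt 𝓘(ℝ, E) x).source with hU
  have hUo : IsOpen U := (continuousOn_extChartAt_symm x₀).isOpen_inter_preimage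
    (isOpen_extChartAt_target x₀) (isOpen_extChartAt_source x)
  have hyU : y ∈ U := ⟨hy, mem_extChartAt_source (I := 𝓘(ℝ, E)) x⟩
  have hd : ∀ z ∈ U, MDifferentiableAt 𝓘(ℝ, E) 𝓘(ℝ, E) (extChartAt 𝓘(ℝ, E) x₀).symm z := by
    intro z hz
    have := mdifferentiableWithinAt_extChartAt_symm (I := 𝓘(ℝ, E)) (x := x₀) hz.1
    simpa [mdifferentiableWithinAt_univ] using this
  have hd' : ∀ z ∈ U, MDifferentiableAt 𝓘(ℝ, E) 𝓘(ℝ, E) (extChartAt 𝓘(ℝ, E) x)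
      ((extChartAt 𝓘(ℝ, E) x₀).symm z) := by
    intro z hz
    refine mdifferentiableAt_extChartAt ?_
    rw [← extChartAt_source 𝓘(ℝ, E)]; exact hz.2
  have hfd : ∀ z ∈ U, fderiv ℝ τ z =
      (mfderiv 𝓘(ℝ, E) 𝓘(ℝ, E) (extChartAt 𝓘(ℝ, E) x) ((extChartAt 𝓘(ℝ, E) x₀).symm z)).comp
      (mfderiv 𝓘(ℝ, E) 𝓘(ℝ, E) (extChartAt 𝓘(ℝ, E) x₀).symm z) := by
    intro z hz
    rw [← mfderiv_eq_fderiv, hτ, mfderiv_comp z (hd' z hz) (hd z hz)]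
  have hinv : ∀ z ∈ U, (mfderiv 𝓘(ℝ, E) 𝓘(ℝ, E) (extChartAt 𝓘(ℝ, E) x).symm (τ z)).comp
      (mfderiv 𝓘(ℝ, E) 𝓘(ℝ, E) (extChartAt 𝓘(ℝ, E) x) ((extChartAt 𝓘(ℝ, E) x₀).symm z))
      = ContinuousLinearMap.id ℝ _ := by
    intro z hz
    have := mfderivWithin_extChartAt_symm_comp_mfderiv_extChartAt' (I := 𝓘(ℝ, E)) (x := x) hz.2
    rw [show range 𝓘(ℝ, E) = univ from by simp, mfderivWithin_univ] at this
    exact this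
  have hτs : ContDiffAt ℝ ∞ τ y := by
    have h := contDiffWithinAt_ext_coord_change (I := 𝓘(ℝ, E)) (n := ∞) x x₀ (y := y)
      (by rw [PartialEquiv.trans_source]; exact hyU)
    rw [show range 𝓘(ℝ, E) = univ from by simp, contDiffWithinAt_univ] at h
    exact h
  have hev : chartRep ϖ x₀ =ᶠ[𝓝 y]
      fun z => (chartRep ϖ x (τ z)).compContinuousLinearMap (fderiv ℝ τ z) := by
    filter_upwards [hUo.mem_nhds hyU] with z hz
    refine (rawForm_pullback_congr ϖ ((extChartAt 𝓘(ℝ, E) x).left_inv hz.2)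
      ((mfderiv 𝓘(ℝ, E) 𝓘(ℝ, E) (extChartAt 𝓘(ℝ, E) x).symm (τ z)).comp (fderiv ℝ τ z))
      (mfderiv 𝓘(ℝ, E) 𝓘(ℝ, E) (extChartAt 𝓘(ℝ, E) x₀).symm z) ?_).symm
    have hτz : fderiv ℝ τ z =
        ((mfderiv 𝓘(ℝ, E) 𝓘(ℝ, E) (extChartAt 𝓘(ℝ, E) x) ((extChartAt 𝓘(ℝ, E) x₀).symm z)) :
          E →L[ℝ] E).comp (mfderiv 𝓘(ℝ, E) 𝓘(ℝ, E) (extChartAt 𝓘(ℝ, E) x₀).symm z) := hfd z hz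
    refine Eq.trans (congrArg (fun (A : E →L[ℝ] E) =>
      (mfderiv 𝓘(ℝ, E) 𝓘(ℝ, E) (extChartAt 𝓘(ℝ, E) x).symm (τ z) : E →L[ℝ] E).comp A) hτz) ?_
    exact congrArg (fun (A : E →L[ℝ] E) => A.comp
      (mfderiv 𝓘(ℝ, E) 𝓘(ℝ, E) (extChartAt 𝓘(ℝ, E) x₀).symm z : E →L[ℝ] E)) (hinv z hz)
  rw [hev.extDeriv_eq, extDeriv_pullback (r := ∞) _ hτs]
  · rw [hfd y hyU]
    rfl
  · rw [minSmoothness_of_isRCLikeNormedField]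
    exact WithTop.coe_le_coe.2 le_top
  · exact (hϖ.contDiffAt x ((extChartAt 𝓘(ℝ, E) x).map_source
      (mem_extChartAt_source (I := 𝓘(ℝ, E)) x))).differentiableAt (by simp)

theorem IsSmoothForm.rawExtDeriv {k : ℕ} {ϖ : RawForm E M k} (hϖ : IsSmoothForm ϖ) :
    IsSmoothForm (rawExtDeriv ϖ) := by
  intro x₀
  refine ContDiffOn.congr ?_ fun y hy => chartRep_rawExtDeriv hϖ x₀ hy
  intro y hy
  have h : ContDiffAt ℝ ∞ (fderiv ℝ (chartRep ϖ x₀)) y :=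
    (hϖ.contDiffAt x₀ hy).fderiv_right (m := ∞) (by simp)
  exact ((ContinuousAlternatingMap.alternatizeUncurryFinCLM ℝ E ℝ).contDiff.contDiffAt.comp y
    h).contDiffWithinAt

variable (E M) in
/-- The de Rham differential `Ω^k(M) → Ω^{k+1}(M)`. -/
def d (k : ℕ) : Form E M k →ₗ[ℝ] Form E M (k + 1) where
  toFun ϖ := ⟨rawExtDeriv ϖ.1, ϖ.2.rawExtDeriv⟩
  map_add' a b := by
    ext1
    funext x
    have hx := mem_extChartAt_target (I := 𝓘(ℝ, E)) x
    have h : extDeriv (chartRep (a.1 + b.1) x) (extChartAt 𝓘(ℝ, E) x x) =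
        extDeriv (chartRep a.1 x) (extChartAt 𝓘(ℝ, E) x x) +
        extDeriv (chartRep b.1 x) (extChartAt 𝓘(ℝ, E) x x) :=
      extDeriv_add ((a.2.contDiffAt x hx).differentiableAt (by simp))
        ((b.2.contDiffAt x hx).differentiableAt (by simp))
    change ContinuousAlternatingMap.compContinuousLinearMap
      (extDeriv (chartRep (a.1 + b.1) x) _) _ = _
    rw [h]
    rfl
  map_smul' c a := by
    ext1
    funext x
    have h : extDeriv (chartRep (c • a.1) x) (extChartAt 𝓘(ℝ, E) x x) =
        c • extDeriv (chartRep a.1 x) (extChartAt 𝓘(ℝ, E) x x) :=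
      extDeriv_smul (x := extChartAt 𝓘(ℝ, E) x x) c (chartRep a.1 x)
    change ContinuousAlternatingMap.compContinuousLinearMap
      (extDeriv (chartRep (c • a.1) x) _) _ = _
    rw [h]
    rfl

/-! ### Smooth functions, vector fields and contractions -/

variable (E M) in
/-- `C^∞(M)`. -/
abbrev Fun : Type _ := C^∞⟮𝓘(ℝ, E), M; ℝ⟯

variable (E M) in
/-- Smooth functions are `0`-forms. -/
def funToForm : Fun E M →ₗ[ℝ] Form E M 0 where
  toFun f := ⟨fun x => ContinuousAlternatingMap.constOfIsEmpty ℝ (TangentSpace 𝓘(ℝ, E) x) (Fin 0)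
    (f x), by
    intro x₀
    have h1 : ContDiffOn ℝ ∞ (f ∘ (extChartAt 𝓘(ℝ, E) x₀).symm)
        (extChartAt 𝓘(ℝ, E) x₀).target :=
      contMDiffOn_iff_contDiffOn.1
        (f.contMDiff.comp_contMDiffOn (contMDiffOn_extChartAt_symm x₀))
    refine ((ContinuousAlternatingMap.constOfIsEmptyLIE ℝ E ℝ
      (Fin 0)).toContinuousLinearEquiv.contDiff.comp_contDiffOn h1).congr fun y _ => ?_
    ext w
    rfl⟩
  map_add' f g := by ext; rfl
  map_smul' c f := by ext; rfl

variable (E M) in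
/-- `0`-forms are smooth functions. -/
def formToFun : Form E M 0 →ₗ[ℝ] Fun E M where
  toFun ϖ := ⟨fun x => ϖ.1 x 0, by
    intro x₀
    have h1 : ContMDiffAt 𝓘(ℝ, E) 𝓘(ℝ, E [⋀^Fin 0]→L[ℝ] ℝ) ∞
        (chartRep ϖ.1 x₀ ∘ extChartAt 𝓘(ℝ, E) x₀) x₀ :=
      ((ϖ.2.contDiffAt x₀ (mem_extChartAt_target x₀)).contMDiffAt).comp x₀ contMDiffAt_extChartAt
    have h2 := ((ContinuousAlternatingMap.constOfIsEmptyLIE ℝ E ℝ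
      (Fin 0)).symm.toContinuousLinearEquiv.contDiff.contDiffAt.contMDiffAt).comp x₀ h1
    refine h2.congr_of_eventuallyEq ?_
    filter_upwards [extChartAt_source_mem_nhds (I := 𝓘(ℝ, E)) x₀] with z hz
    have : (extChartAt 𝓘(ℝ, E) x₀).symm (extChartAt 𝓘(ℝ, E) x₀ z) = z :=
      (extChartAt 𝓘(ℝ, E) x₀).left_inv hz
    change ϖ.1 z 0 = ϖ.1 ((extChartAt 𝓘(ℝ, E) x₀).symm (extChartAt 𝓘(ℝ, E) x₀ z)) _
    rw [this]
    congr 1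
    exact Subsingleton.elim _ _⟩
  map_add' f g := by ext; rfl
  map_smul' c f := by ext; rfl

variable (E M) in
/-- The de Rham differential `C^∞(M) → Ω^1(M)`. -/
def dFun : Fun E M →ₗ[ℝ] Form E M 1 := d E M 0 ∘ₗ funToForm E M

variable (E M) in
/-- The first de Rham cohomology `H^1(M)`: closed `1`-forms modulo exact ones. -/
abbrev DeRhamH1 : Type _ :=
  LinearMap.ker (d E M 1) ⧸ (LinearMap.range (dFun E M)).submoduleOf (LinearMap.ker (d E M 1))

variable (E M) in
/-- `𝔛(M)`, the smooth vector fields. -/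
abbrev VField : Type _ :=
  ContMDiffSection 𝓘(ℝ, E) E ∞ (TangentSpace 𝓘(ℝ, E) : M → Type _)

theorem isSmoothForm_contract [CompleteSpace E] {k : ℕ} (v : VField E M) {ϖ : RawForm E M (k + 1)}
    (hϖ : IsSmoothForm ϖ) : IsSmoothForm (fun x => contractAt (v x) (ϖ x)) := by
  have : IsManifold 𝓘(ℝ, E) 1 M := IsManifold.of_le (n := ∞) (by simp)
  intro x₀ y hy
  set V : E → E := VectorField.mpullback 𝓘(ℝ, E) 𝓘(ℝ, E) (extChartAt 𝓘(ℝ, E) x₀).symm v with hV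
  have hinv : ∀ z ∈ (extChartAt 𝓘(ℝ, E) x₀).target,
      (mfderiv 𝓘(ℝ, E) 𝓘(ℝ, E) (extChartAt 𝓘(ℝ, E) x₀).symm z).IsInvertible := by
    intro z hz
    have := isInvertible_mfderivWithin_extChartAt_symm (I := 𝓘(ℝ, E)) hz
    rwa [show range 𝓘(ℝ, E) = univ from by simp, mfderivWithin_univ] at this
  have hVs : ContDiffAt ℝ ∞ V y := by
    rw [← contMDiffAt_vectorSpace_iff_contDiffAt]
    refine ContMDiffAt.mpullback_vectorField_preimage (n := ∞) (v.contMDiff _) ?_ (hinv y hy)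
      (by simp)
    exact (contMDiffOn_extChartAt_symm x₀).contMDiffAt
      ((isOpen_extChartAt_target x₀).mem_nhds hy)
  have h := ((ContinuousAlternatingMap.curryLeftLI (𝕜 := ℝ) (E := E) (F := ℝ)
    (n := k)).contDiff.contDiffAt.comp y (hϖ.contDiffAt x₀ hy)).clm_apply hVs
  refine (h.congr_of_eventuallyEq ?_).contDiffWithinAt
  filter_upwards [(isOpen_extChartAt_target (I := 𝓘(ℝ, E)) x₀).mem_nhds hy] with z hz
  ext u
  change ϖ _ (Matrix.vecCons _ _) = ϖ _ _
  congr 1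
  funext i
  refine Fin.cases ?_ (fun j => rfl) i
  exact ((hinv z hz).self_apply_inverse _).symm

variable [FiniteDimensional ℝ E]

/-- Contraction `ι_v : Ω^{k+1}(M) → Ω^k(M)` with a vector field. -/
def contract {k : ℕ} (v : VField E M) (ϖ : Form E M (k + 1)) : Form E M k :=
  ⟨fun x => contractAt (v x) (ϖ.1 x),
    have : CompleteSpace E := FiniteDimensional.complete ℝ E
    isSmoothForm_contract v ϖ.2⟩

theorem contract_add {k : ℕ} (v w : VField E M) (ϖ : Form E M (k + 1)) :
    contract (v + w) ϖ = contract v ϖ + contract w ϖ := by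
  ext1
  funext x
  exact map_add (ContinuousAlternatingMap.curryLeft (𝕜 := ℝ) (E := E) (ϖ.1 x)) (v x) (w x)

theorem contract_smul {k : ℕ} (c : ℝ) (v : VField E M) (ϖ : Form E M (k + 1)) :
    contract (c • v) ϖ = c • contract v ϖ := by
  ext1
  funext x
  exact map_smul (ContinuousAlternatingMap.curryLeft (𝕜 := ℝ) (E := E) (ϖ.1 x)) c (v x)

/-! ### 2-plectic forms, Hamiltonian forms and the Lie 2-algebra of observables -/

/-- `ϖ` is 2-plectic: closed and nondegenerate, i.e. `v ↦ ι_v ϖ` is injective on every tangent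
space. -/
structure IsTwoPlectic (ϖ : Form E M 3) : Prop where
  closed : d E M 3 ϖ = 0
  nondegenerate : ∀ x : M,
    Function.Injective fun v : TangentSpace 𝓘(ℝ, E) x => contractAt v (ϖ.1 x)

/-- `v` is a Hamiltonian vector field of the `1`-form `α`: `dα = -ι_v ϖ`. -/
def IsHamVF (ϖ : Form E M 3) (α : Form E M 1) (v : VField E M) : Prop :=
  d E M 1 α = -contract v ϖ

/-- `Ω^1_Ham(M)`. -/
def HamForm (ϖ : Form E M 3) : Submodule ℝ (Form E M 1) where
  carrier := {α | ∃ v : VField E M, IsHamVF ϖ α v}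
  add_mem' := by
    rintro α β ⟨v, hv⟩ ⟨w, hw⟩
    refine ⟨v + w, ?_⟩
    simp only [IsHamVF] at *
    rw [map_add, hv, hw, contract_add]
    abel
  zero_mem' := ⟨0, by
    have h := contract_smul (0 : ℝ) (0 : VField E M) ϖ
    simp only [zero_smul] at h
    simp [IsHamVF, h]⟩
  smul_mem' := by
    rintro c α ⟨v, hv⟩
    refine ⟨c • v, ?_⟩
    simp only [IsHamVF] at *
    rw [map_smul, hv, contract_smul, smul_neg]

/-- A Hamiltonian vector field `v_α` of a Hamiltonian form `α`. -/
def hamVF {ϖ : Form E M 3} (α : HamForm ϖ) : VField E M := α.2.choose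

/-- The sign `ζ(k) = -(-1)^{k(k+1)/2}`. -/
def zeta (k : ℕ) : ℝ := -(-1) ^ (k * (k + 1) / 2)

/-- `i(u ∧ v) ϖ = ι_v ι_u ϖ`. -/
def contract₂ (u v : VField E M) (ϖ : Form E M 3) : Form E M 1 := contract v (contract u ϖ)

/-- `i(u ∧ v ∧ w) ϖ = ι_w ι_v ι_u ϖ`. -/
def contract₃ (u v w : VField E M) (ϖ : Form E M 3) : Fun E M :=
  formToFun E M (contract w (contract v (contract u ϖ)))

/-- Binary bracket of `L_∞(M, ϖ)` on degree `0` elements; it vanishes in all other degrees. -/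
def obsBracket₂ {ϖ : Form E M 3} (α β : HamForm ϖ) : Form E M 1 :=
  zeta 2 • contract₂ (hamVF α) (hamVF β) ϖ

/-- Trinary bracket of `L_∞(M, ϖ)` on degree `0` elements; it vanishes in all other degrees. -/
def obsBracket₃ {ϖ : Form E M 3} (α β γ : HamForm ϖ) : Fun E M :=
  zeta 3 • contract₃ (hamVF α) (hamVF β) (hamVF γ) ϖ

end
end Forms

/-! ### Minimal Lie 2-algebras and their Chevalley–Eilenberg complex -/

section Lie2

theorem update_pair_zero {V : Type*} (p q r : V) : Function.update ![p, r] 0 q = ![q, r] := by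
  ext i; fin_cases i <;> rfl

theorem update_pair_one {V : Type*} (p q r : V) : Function.update ![r, p] 1 q = ![r, q] := by
  ext i; fin_cases i <;> rfl

/-- A minimal (zero unary bracket) Lie 2-algebra `𝔥[1] ⊕ 𝔤` whose bracket `∧²𝔤 → 𝔤` is the given
Lie bracket: the remaining brackets `𝔤 ⊗ 𝔥 → 𝔥` and `∧³𝔤 → 𝔥`, with the higher Jacobi
identities. -/
structure MinimalLie2Algebra (𝔤 : Type*) [LieRing 𝔤] [LieAlgebra ℝ 𝔤]
    (𝔥 : Type*) [AddCommGroup 𝔥] [Module ℝ 𝔥] where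
  /-- `[x, h]` -/
  act : 𝔤 →ₗ[ℝ] 𝔥 →ₗ[ℝ] 𝔥
  /-- `[x, y, z]` -/
  tri : 𝔤 [⋀^Fin 3]→ₗ[ℝ] 𝔥
  act_lie : ∀ x y h, act ⁅x, y⁆ h = act x (act y h) - act y (act x h)
  tri_cocycle : ∀ x y z u,
    act x (tri ![y, z, u]) - act y (tri ![x, z, u]) + act z (tri ![x, y, u])
        - act u (tri ![x, y, z])
      = tri ![⁅x, y⁆, z, u] + tri ![y, ⁅x, z⁆, u] + tri ![y, z, ⁅x, u⁆]
        - tri ![x, ⁅y, z⁆, u] - tri ![x, z, ⁅y, u⁆] + tri ![x, y, ⁅z, u⁆]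

variable {𝔤 : Type*} [LieRing 𝔤] [LieAlgebra ℝ 𝔤] {𝔥 : Type*} [AddCommGroup 𝔥] [Module ℝ 𝔥]
  {A : Type*} [AddCommGroup A] [Module ℝ A]

variable (𝔤 A) in
/-- `CE(L)^1 ⊗ A = 𝔤* ⊗ A`, as linear maps `𝔤 → A`. -/
abbrev CE1 : Type _ := 𝔤 →ₗ[ℝ] A

variable (𝔤 𝔥 A) in
/-- `CE(L)^2 ⊗ A = (𝔥* ⊕ ∧²𝔤*) ⊗ A`. -/
abbrev CE2 : Type _ := (𝔥 →ₗ[ℝ] A) × (𝔤 [⋀^Fin 2]→ₗ[ℝ] A)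

variable (𝔤 𝔥 A) in
/-- `CE(L)^3 ⊗ A = (𝔤* ⊗ 𝔥* ⊕ ∧³𝔤*) ⊗ A`. -/
abbrev CE3 : Type _ := (𝔤 →ₗ[ℝ] 𝔥 →ₗ[ℝ] A) × (𝔤 [⋀^Fin 3]→ₗ[ℝ] A)

/-- Lie algebra differential of a `1`-cochain: `(x, y) ↦ -ξ([x, y])`. -/
def dLie1 (ξ : 𝔤 →ₗ[ℝ] A) : 𝔤 [⋀^Fin 2]→ₗ[ℝ] A where
  toFun v := -ξ ⁅v 0, v 1⁆
  map_update_add' v i a b := by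
    have : ‹DecidableEq (Fin 2)› = instDecidableEqFin 2 := Subsingleton.elim _ _
    subst this
    fin_cases i <;> simp [add_comm]
  map_update_smul' v i c a := by
    have : ‹DecidableEq (Fin 2)› = instDecidableEqFin 2 := Subsingleton.elim _ _
    subst this
    fin_cases i <;> simp
  map_eq_zero_of_eq' v i j h hij := by
    fin_cases i <;> fin_cases j <;> simp_all

/-- Lie algebra differential of a `2`-cochain:
`(x, y, z) ↦ -ξ([x, y], z) + ξ([x, z], y) - ξ([y, z], x)`. -/
def dLie2 (ξ : 𝔤 [⋀^Fin 2]→ₗ[ℝ] A) : 𝔤 [⋀^Fin 3]→ₗ[ℝ] A where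
  toFun v := -ξ ![⁅v 0, v 1⁆, v 2] + ξ ![⁅v 0, v 2⁆, v 1] - ξ ![⁅v 1, v 2⁆, v 0]
  map_update_add' v i a b := by
    have : ‹DecidableEq (Fin 3)› = instDecidableEqFin 3 := Subsingleton.elim _ _
    subst this
    have h1 : ∀ p q r : 𝔤, ξ ![p + q, r] = ξ ![p, r] + ξ ![q, r] := fun p q r => by
      simpa only [update_pair_zero] using ξ.map_update_add ![p, r] 0 p q
    have h2 : ∀ p q r : 𝔤, ξ ![r, p + q] = ξ ![r, p] + ξ ![r, q] := fun p q r => by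
      simpa only [update_pair_one] using ξ.map_update_add ![r, p] 1 p q
    fin_cases i <;> simp [h1, h2] <;> abel
  map_update_smul' v i c a := by
    have : ‹DecidableEq (Fin 3)› = instDecidableEqFin 3 := Subsingleton.elim _ _
    subst this
    have h1 : ∀ (t : ℝ) (p r : 𝔤), ξ ![t • p, r] = t • ξ ![p, r] := fun t p r => by
      simpa only [update_pair_zero] using ξ.map_update_smul ![p, r] 0 t p
    have h2 : ∀ (t : ℝ) (p r : 𝔤), ξ ![r, t • p] = t • ξ ![r, p] := fun t p r => by
      simpa only [update_pair_one] using ξ.map_update_smul ![r, p] 1 t p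
    fin_cases i <;> simp [h1, h2, smul_sub, smul_add]
  map_eq_zero_of_eq' v i j h hij := by
    have h0 : ∀ p : 𝔤, ξ ![0, p] = 0 := fun p => ξ.map_coord_zero 0 rfl
    have h1 : ∀ p q : 𝔤, ξ ![⁅p, q⁆, p] = -ξ ![⁅q, p⁆, p] := fun p q => by
      rw [← lie_skew]
      simpa only [update_pair_zero] using ξ.map_update_neg ![⁅q, p⁆, p] 0 ⁅q, p⁆
    fin_cases i <;> fin_cases j <;> simp_all

/-- Chevalley–Eilenberg differential `CE(L)^1 → CE(L)^2` (with coefficients). -/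
def dCE1 (ξ : CE1 𝔤 A) : CE2 𝔤 𝔥 A := (0, dLie1 ξ)

/-- Chevalley–Eilenberg differential `-d₂ + d₃ : CE(L)^2 → CE(L)^3` (with coefficients). -/
def dCE2 (L : MinimalLie2Algebra 𝔤 𝔥) (ξ : CE2 𝔤 𝔥 A) : CE3 𝔤 𝔥 A :=
  (-(LinearMap.llcomp ℝ 𝔥 𝔥 A ξ.1 ∘ₗ L.act), dLie2 ξ.2 - ξ.1.compAlternatingMap L.tri)

end Lie2

/-! ### Moment maps -/

section Moment

variable {E : Type*} [NormedAddCommGroup E] [NormedSpace ℝ E] [FiniteDimensional ℝ E]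
  {M : Type*} [TopologicalSpace M] [ChartedSpace E M] [IsManifold 𝓘(ℝ, E) ∞ M]
  {𝔤 : Type*} [LieRing 𝔤] [LieAlgebra ℝ 𝔤] {𝔥 : Type*} [AddCommGroup 𝔥] [Module ℝ 𝔥]

variable (E M 𝔤) in
/-- `C^1 = 𝔤[1]* ⊗ C^∞(M)` in the total complex `C = CE(L) ⊗ Ω(M)`. -/
abbrev C1 : Type _ := CE1 𝔤 (Fun E M)

variable (E M 𝔤 𝔥) in
/-- `C^2 = 𝔤[1]* ⊗ Ω^1(M) ⊕ (𝔥[2]* ⊕ S²(𝔤[1])*) ⊗ C^∞(M)`. -/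
abbrev C2 : Type _ := CE1 𝔤 (Form E M 1) × CE2 𝔤 𝔥 (Fun E M)

/-- The total differential `d_CE ⊗ 1 + 1 ⊗ d_dR : C^1 → C^2`, with the Koszul sign
`(1 ⊗ d_dR)(ξ ⊗ f) = -ξ ⊗ df` for `ξ` of degree `1`. -/
def dTot1 (α : C1 E M 𝔤) : C2 E M 𝔤 𝔥 := (-(dFun E M ∘ₗ α), dCE1 α)

variable (E M) in
/-- Evaluation of functions at `p`. -/
def evalFun (p : M) : Fun E M →ₗ[ℝ] ℝ where
  toFun f := f p
  map_add' _ _ := rfl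
  map_smul' _ _ := rfl

variable (E M) in
/-- Evaluation of vector fields at `p`. -/
def evalVF (p : M) : VField E M →ₗ[ℝ] TangentSpace 𝓘(ℝ, E) p where
  toFun v := v p
  map_add' _ _ := rfl
  map_smul' _ _ := rfl

/-- `r : C^2 → CE(L)^2`, evaluating the function components at `p` and killing the component of
positive form degree. -/
def evalC2 (p : M) (μ : C2 E M 𝔤 𝔥) : CE2 𝔤 𝔥 ℝ :=
  (evalFun E M p ∘ₗ μ.2.1, (evalFun E M p).compAlternatingMap μ.2.2)

variable (𝔤) in
/-- An infinitesimal action of `𝔤` on `(M, ϖ)`: a Lie algebra morphism `x ↦ v_x` to `𝔛(M)` with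
values in Hamiltonian vector fields. -/
structure HamAction (ϖ : Form E M 3) where
  /-- `x ↦ v_x` -/
  vf : 𝔤 →ₗ[ℝ] VField E M
  map_lie : ∀ (x y : 𝔤) (q : M),
    vf ⁅x, y⁆ q = VectorField.mlieBracket 𝓘(ℝ, E) (fun m => vf x m) (fun m => vf y m) q
  hamiltonian : ∀ x : 𝔤, ∃ α : Form E M 1, IsHamVF ϖ α (vf x)

/-- `ω_{3p}(x, y, z) = ϖ(v_x, v_y, v_z)|_p`, as an element of `CE(L)^3`. -/
def omega3 {ϖ : Form E M 3} (ρ : HamAction 𝔤 ϖ) (p : M) : CE3 𝔤 𝔥 ℝ :=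
  (0, (ϖ.1 p).toAlternatingMap.compLinearMap (evalVF E M p ∘ₗ ρ.vf))

/-- `L_∞`-morphisms `𝔥[1] ⊕ 𝔤 → L_∞(M, ϖ)` in components (the unary bracket of the source is
`0`). -/
structure IsLInftyMorphism (L : MinimalLie2Algebra 𝔤 𝔥) {ϖ : Form E M 3} (f₁ : 𝔤 →ₗ[ℝ] HamForm ϖ)
    (f₁' : 𝔥 →ₗ[ℝ] Fun E M) (f₂ : 𝔤 [⋀^Fin 2]→ₗ[ℝ] Fun E M) : Prop where
  unary : ∀ h, dFun E M (f₁' h) = 0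
  binary : ∀ x y, dFun E M (f₂ ![x, y]) = f₁ ⁅x, y⁆ - obsBracket₂ (f₁ x) (f₁ y)
  mixed : ∀ h x, f₁' (-L.act x h) = 0
  trinary : ∀ x y z, f₁' (L.tri ![x, y, z]) - obsBracket₃ (f₁ x) (f₁ y) (f₁ z)
    = f₂ ![x, ⁅y, z⁆] - f₂ ![y, ⁅x, z⁆] + f₂ ![z, ⁅x, y⁆]

/-- `μ ∈ C^2` is a moment map for `L = 𝔥[1] ⊕ 𝔤`: its components form an `L_∞`-morphism
`L → L_∞(M, ϖ)` with `-ι_{v_x} ϖ = d μ(x)`. -/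
def IsMomentMap (L : MinimalLie2Algebra 𝔤 𝔥) {ϖ : Form E M 3} (ρ : HamAction 𝔤 ϖ)
    (μ : C2 E M 𝔤 𝔥) : Prop :=
  ∃ f₁ : 𝔤 →ₗ[ℝ] HamForm ϖ, (∀ x, (f₁ x : Form E M 1) = μ.1 x) ∧
    IsLInftyMorphism L f₁ μ.2.1 μ.2.2 ∧ ∀ x, IsHamVF ϖ (f₁ x) (ρ.vf x)

/-- Inner equivalence of moment maps. -/
def InnerEquivalent (L : MinimalLie2Algebra 𝔤 𝔥) {ϖ : Form E M 3} (ρ : HamAction 𝔤 ϖ)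
    (μ μ' : C2 E M 𝔤 𝔥) : Prop :=
  IsMomentMap L ρ μ ∧ IsMomentMap L ρ μ' ∧ ∃ α : C1 E M 𝔤, μ - μ' = dTot1 α

/-- `γ₂ : ∧²𝔤 → C^∞(M)` satisfies `γ₁([x, y]) - i(v_x ∧ v_y)ϖ = d(γ₂(x, y))` and
`γ₂(x, y)|_p = 0`. -/
def IsGammaTwo {ϖ : Form E M 3} (ρ : HamAction 𝔤 ϖ) (p : M) (γ₁ : 𝔤 →ₗ[ℝ] HamForm ϖ)
    (γ₂ : 𝔤 [⋀^Fin 2]→ₗ[ℝ] Fun E M) : Prop :=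
  ∀ x y, (γ₁ ⁅x, y⁆ : Form E M 1) - contract₂ (ρ.vf x) (ρ.vf y) ϖ = dFun E M (γ₂ ![x, y]) ∧
    γ₂ ![x, y] p = 0

/-- The map `γ` for `ℝ[1] ⊕ 𝔤`, with components `γ₁` on `𝔤`, constant functions `r ↦ r` on `ℝ`,
and `γ₂`. -/
def gammaMap {ϖ : Form E M 3} (γ₁ : 𝔤 →ₗ[ℝ] HamForm ϖ) (γ₂ : 𝔤 [⋀^Fin 2]→ₗ[ℝ] Fun E M) :
    C2 E M 𝔤 ℝ :=
  ((HamForm ϖ).subtype ∘ₗ γ₁, Algebra.linearMap ℝ (Fun E M), γ₂)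

/-- Composition `γ ∘ f` where `f : 𝔥[1] ⊕ 𝔤 → ℝ[1] ⊕ 𝔤` has components `f₁ = (η|_𝔥, Id_𝔤)` and
`f₂ = η|_{∧²𝔤}`: on `𝔤` it is `γ₁`, on `𝔥` it is `γ₁ ∘ η|_𝔥`, and its binary component is
`γ₁(η(x, y)) + γ₂(x, y)`. -/
def compEta (γ : C2 E M 𝔤 ℝ) (η : CE2 𝔤 𝔥 ℝ) : C2 E M 𝔤 𝔥 :=
  (γ.1, γ.2.1 ∘ₗ η.1, γ.2.1.compAlternatingMap η.2 + γ.2.2)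

/-- `φ^η`. -/
def phi {ϖ : Form E M 3} (γ₁ : 𝔤 →ₗ[ℝ] HamForm ϖ) (γ₂ : 𝔤 [⋀^Fin 2]→ₗ[ℝ] Fun E M)
    (η : CE2 𝔤 𝔥 ℝ) : C2 E M 𝔤 𝔥 :=
  compEta (gammaMap γ₁ γ₂) η

end Moment

end MomentMap

end

open MomentMap

/-!
The proof rests on two facts about `d : C^∞(M) → Ω^1(M)` on a connected manifold: a function is
determined by its differential and its value at `p` (`eq_of_dFun_eq`), and, when `H^1(M) = 0`, a
linear family of closed `1`-forms has a linear family of primitives vanishing at `p`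
(`exists_linear_primitive`).

Nondegeneracy of `ϖ` makes Hamiltonian vector fields unique, so the brackets of observables
occurring in a moment map are contractions of `ϖ` with the fields `v_x`. Its trinary equation, rearranged by
skew symmetry and evaluated at `p`, is `d_CE r(μ) = ω_{3p}`.

Both `μ(x)` and `γ₁(x)` have differential `-ι_{v_x} ϖ`, so `μ(x) - γ₁(x) = d(β(x))` with `β` linear
and `β(x)(p) = 0`. Then `γ₂(x, y) = μ₂(x, y) - β([x, y]) - μ₂(x, y)(p)`, which exists by this formula
and is unique by the first fact. Since `d μ(h) = 0`, the function `μ(h)` is constant, and therefore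
`μ - φ^{r(μ)} = (dβ, 0, β([x, y])) = d_tot(-β)`. The two binary components differ by the
Chevalley–Eilenberg coboundary of `β`, which by the Jacobi identity does not affect the trinary
equation, so `φ^{r(μ)}` is again a moment map.
-/

namespace MomentMap

section Calculus

/-! ### Functions with a given differential -/

variable {E : Type*} [NormedAddCommGroup E] [NormedSpace ℝ E]
  {M : Type*} [TopologicalSpace M] [ChartedSpace E M] [IsManifold 𝓘(ℝ, E) ∞ M]

theorem chartRep_funToForm (f : Fun E M) (x₀ : M) :
    chartRep (funToForm E M f).1 x₀ = fun y => ContinuousAlternatingMap.constOfIsEmpty ℝ E (Fin 0)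
      (f ((extChartAt 𝓘(ℝ, E) x₀).symm y)) := by
  funext y
  ext w
  rfl

theorem contDiffOn_comp_extChartAt_symm (f : Fun E M) (x₀ : M) :
    ContDiffOn ℝ ∞ (fun y => f ((extChartAt 𝓘(ℝ, E) x₀).symm y))
      (extChartAt 𝓘(ℝ, E) x₀).target :=
  contMDiffOn_iff_contDiffOn.1
    (f.contMDiff.comp_contMDiffOn (contMDiffOn_extChartAt_symm x₀))

theorem fderiv_comp_extChartAt_symm_of_dFun_eq_zero {f : Fun E M} (hf : dFun E M f = 0) (x₀ : M)
    {y : E} (hy : y ∈ (extChartAt 𝓘(ℝ, E) x₀).target) :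
    fderiv ℝ (fun y => f ((extChartAt 𝓘(ℝ, E) x₀).symm y)) y = 0 := by
  have h0 : rawExtDeriv (funToForm E M f).1 = 0 := congrArg Subtype.val hf
  have h := chartRep_rawExtDeriv (funToForm E M f).2 x₀ hy
  rw [h0, chartRep_funToForm, extDeriv_constOfIsEmpty] at h
  ext u
  exact (congrArg (fun φ : E [⋀^Fin 1]→L[ℝ] ℝ => φ fun _ => u) h).symm

theorem apply_eq_of_dFun_eq_zero [PreconnectedSpace M] {f : Fun E M} (hf : dFun E M f = 0)
    (x y : M) : f x = f y := by
  refine IsLocallyConstant.apply_eq_of_preconnectedSpace ?_ x y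
  rw [IsLocallyConstant.iff_eventually_eq]
  intro x₀
  have hopen := (isOpen_extChartAt_target (I := 𝓘(ℝ, E)) x₀).isOpen_inter_preimage_of_fderiv_eq_zero
    ((contDiffOn_comp_extChartAt_symm f x₀).differentiableOn (by simp))
    (fun y hy => fderiv_comp_extChartAt_symm_of_dFun_eq_zero hf x₀ hy) {f x₀}
  have hmem : extChartAt 𝓘(ℝ, E) x₀ x₀ ∈ (extChartAt 𝓘(ℝ, E) x₀).target ∩
      (fun y => f ((extChartAt 𝓘(ℝ, E) x₀).symm y)) ⁻¹' {f x₀} :=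
    ⟨mem_extChartAt_target x₀, by simp⟩
  filter_upwards [extChartAt_source_mem_nhds (I := 𝓘(ℝ, E)) x₀,
    (continuousAt_extChartAt (I := 𝓘(ℝ, E)) x₀).preimage_mem_nhds (hopen.mem_nhds hmem)] with z hz h
  have h2 : f ((extChartAt 𝓘(ℝ, E) x₀).symm (extChartAt 𝓘(ℝ, E) x₀ z)) = f x₀ := h.2
  rwa [(extChartAt 𝓘(ℝ, E) x₀).left_inv hz] at h2

theorem eq_of_dFun_eq [PreconnectedSpace M] {f g : Fun E M} (h : dFun E M f = dFun E M g) {p : M}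
    (hp : f p = g p) : f = g := by
  ext x
  have h0 : (f - g) x = (f - g) p :=
    apply_eq_of_dFun_eq_zero (by rw [map_sub, h, sub_self]) x p
  have h1 : f x - g x = f p - g p := h0
  linarith

theorem dFun_algebraMap (c : ℝ) : dFun E M (algebraMap ℝ (Fun E M) c) = 0 := by
  ext1
  funext x
  have h : extDeriv (chartRep (funToForm E M (algebraMap ℝ (Fun E M) c)).1 x)
      (extChartAt 𝓘(ℝ, E) x x) = 0 := by
    rw [chartRep_funToForm, extDeriv_constOfIsEmpty]
    change ContinuousAlternatingMap.ofSubsingleton ℝ E ℝ (0 : Fin 1)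
      (fderiv ℝ (fun _ : E => c) _) = 0
    rw [fderiv_const_apply]
    rfl
  change ContinuousAlternatingMap.compContinuousLinearMap (extDeriv _ _) _ = _
  rw [h]
  rfl

/-- A linear family of closed `1`-forms on a connected manifold with `H^1(M) = 0` has a linear
family of primitives vanishing at `p`: on functions vanishing at `p` the differential is injective,
so it can be inverted on its range. -/
theorem exists_linear_primitive [PreconnectedSpace M] (hH1 : Subsingleton (DeRhamH1 E M)) (p : M)
    {V : Type*} [AddCommGroup V] [Module ℝ V] (σ : V →ₗ[ℝ] Form E M 1)
    (hσ : ∀ x, d E M 1 (σ x) = 0) :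
    ∃ β : V →ₗ[ℝ] Fun E M, (∀ x, dFun E M (β x) = σ x) ∧ ∀ x, β x p = 0 := by
  let D : LinearMap.ker (evalFun E M p) →ₗ[ℝ] Form E M 1 :=
    dFun E M ∘ₗ (LinearMap.ker (evalFun E M p)).subtype
  have hD : Function.Injective D := fun f g h =>
    Subtype.ext (eq_of_dFun_eq (p := p) h
      ((show f.1 p = 0 from f.2).trans (show g.1 p = 0 from g.2).symm))
  have hrange : ∀ x, σ x ∈ LinearMap.range D := by
    intro x
    have htop := Submodule.Quotient.subsingleton_iff.1 hH1
    have hmem : (⟨σ x, hσ x⟩ : LinearMap.ker (d E M 1)) ∈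
        (LinearMap.range (dFun E M)).submoduleOf (LinearMap.ker (d E M 1)) :=
      htop ▸ Submodule.mem_top
    obtain ⟨f, hf⟩ : ∃ f, dFun E M f = σ x := hmem
    refine ⟨⟨f - algebraMap ℝ (Fun E M) (f p), ?_⟩, ?_⟩
    · exact sub_self (f p)
    · change dFun E M (f - algebraMap ℝ (Fun E M) (f p)) = σ x
      rw [map_sub, dFun_algebraMap, sub_zero, hf]
  let e := LinearEquiv.ofInjective D hD
  refine ⟨(LinearMap.ker (evalFun E M p)).subtype ∘ₗ e.symm.toLinearMap ∘ₗ
    σ.codRestrict (LinearMap.range D) hrange, fun x => ?_, fun x => ?_⟩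
  · exact congrArg Subtype.val (e.apply_symm_apply ⟨σ x, hrange x⟩)
  · exact (e.symm ⟨σ x, hrange x⟩).2

end Calculus

section Algebra

/-! ### Alternating maps in two and three arguments -/

variable {V A : Type*} [AddCommGroup V] [Module ℝ V] [AddCommGroup A] [Module ℝ A]

theorem alternatingMap_pair_swap (ξ : V [⋀^Fin 2]→ₗ[ℝ] A) (x y : V) : ξ ![x, y] = -ξ ![y, x] := by
  rw [← ξ.map_swap ![y, x] (show (0 : Fin 2) ≠ 1 by decide)]
  congr 1
  ext i
  fin_cases i <;> rfl

theorem alternatingMap_ext_two {ξ η : V [⋀^Fin 2]→ₗ[ℝ] A}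
    (h : ∀ x y, ξ ![x, y] = η ![x, y]) : ξ = η := by
  ext v
  have hv : v = ![v 0, v 1] := by
    ext i
    fin_cases i <;> rfl
  rw [hv, h]

theorem alternatingMap_ext_three {ξ η : V [⋀^Fin 3]→ₗ[ℝ] A}
    (h : ∀ x y z, ξ ![x, y, z] = η ![x, y, z]) : ξ = η := by
  ext v
  have hv : v = ![v 0, v 1, v 2] := by
    ext i
    fin_cases i <;> rfl
  rw [hv, h]

end Algebra

section Moment

/-! ### Moment maps in terms of the action -/

variable {E : Type*} [NormedAddCommGroup E] [NormedSpace ℝ E] [FiniteDimensional ℝ E]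
  {M : Type*} [TopologicalSpace M] [ChartedSpace E M] [IsManifold 𝓘(ℝ, E) ∞ M]
  {𝔤 : Type*} [LieRing 𝔤] [LieAlgebra ℝ 𝔤] {𝔥 : Type*} [AddCommGroup 𝔥] [Module ℝ 𝔥]
  {L : MinimalLie2Algebra 𝔤 𝔥} {ϖ : Form E M 3} {ρ : HamAction 𝔤 ϖ}

/-- The Hamiltonian vector field of a form is unique, by nondegeneracy. -/
theorem hamVF_eq (hϖ : IsTwoPlectic ϖ) {α : HamForm ϖ} {v : VField E M}
    (h : IsHamVF ϖ (α : Form E M 1) v) : hamVF α = v := by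
  have h' : IsHamVF ϖ (α : Form E M 1) (hamVF α) := α.2.choose_spec
  have hc : contract (hamVF α) ϖ = contract v ϖ := neg_injective (h'.symm.trans h)
  ext x
  exact hϖ.nondegenerate x (congrFun (congrArg Subtype.val hc) x)

theorem zeta_two : zeta 2 = 1 := by norm_num [zeta]

theorem zeta_three : zeta 3 = -1 := by norm_num [zeta]

theorem contract₃_apply (u v w : VField E M) (p : M) :
    contract₃ u v w ϖ p = ϖ.1 p ![u p, v p, w p] := by
  change ϖ.1 p _ = ϖ.1 p _
  congr 1
  ext i
  fin_cases i <;> rfl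

/-- For a lift `f₁` of the action, being an `L_∞`-morphism to the observables is expressed by
contractions of `ϖ` with the fields of the action. -/
theorem isLInftyMorphism_iff (hϖ : IsTwoPlectic ϖ) {f₁ : 𝔤 →ₗ[ℝ] HamForm ϖ}
    (hf₁ : ∀ x, IsHamVF ϖ (f₁ x) (ρ.vf x)) (f₁' : 𝔥 →ₗ[ℝ] Fun E M)
    (f₂ : 𝔤 [⋀^Fin 2]→ₗ[ℝ] Fun E M) :
    IsLInftyMorphism L f₁ f₁' f₂ ↔
      (∀ h, dFun E M (f₁' h) = 0) ∧
      (∀ x y, dFun E M (f₂ ![x, y]) = f₁ ⁅x, y⁆ - contract₂ (ρ.vf x) (ρ.vf y) ϖ) ∧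
      (∀ h x, f₁' (L.act x h) = 0) ∧
      ∀ x y z, f₁' (L.tri ![x, y, z]) + contract₃ (ρ.vf x) (ρ.vf y) (ρ.vf z) ϖ
        = f₂ ![x, ⁅y, z⁆] - f₂ ![y, ⁅x, z⁆] + f₂ ![z, ⁅x, y⁆] := by
  have hv : ∀ x, hamVF (f₁ x) = ρ.vf x := fun x => hamVF_eq hϖ (hf₁ x)
  constructor
  · rintro ⟨h1, h2, h3, h4⟩
    refine ⟨h1, fun x y => ?_, fun h x => ?_, fun x y z => ?_⟩
    · simpa only [obsBracket₂, hv, zeta_two, one_smul] using h2 x y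
    · simpa only [map_neg, neg_eq_zero] using h3 h x
    · simpa only [obsBracket₃, hv, zeta_three, neg_smul, one_smul, sub_neg_eq_add] using h4 x y z
  · rintro ⟨h1, h2, h3, h4⟩
    refine ⟨h1, fun x y => ?_, fun h x => ?_, fun x y z => ?_⟩
    · simpa only [obsBracket₂, hv, zeta_two, one_smul] using h2 x y
    · simpa only [map_neg, neg_eq_zero] using h3 h x
    · simpa only [obsBracket₃, hv, zeta_three, neg_smul, one_smul, sub_neg_eq_add] using h4 x y z

theorem IsMomentMap.dCE2_evalC2 (hϖ : IsTwoPlectic ϖ) {μ : C2 E M 𝔤 𝔥} (hμ : IsMomentMap L ρ μ)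
    (p : M) : dCE2 L (evalC2 p μ) = omega3 ρ p := by
  obtain ⟨f₁, -, hmor, hham⟩ := hμ
  obtain ⟨-, -, hmix, htri⟩ := (isLInftyMorphism_iff hϖ hham _ _).1 hmor
  refine Prod.ext ?_ (alternatingMap_ext_three fun x y z => ?_)
  · ext x h
    change -(μ.2.1 (L.act x h) p) = 0
    rw [hmix h x]
    exact neg_zero
  · have h := congrArg (evalFun E M p) (htri x y z)
    rw [alternatingMap_pair_swap _ x, alternatingMap_pair_swap _ y,
      alternatingMap_pair_swap _ z] at h
    have h' : μ.2.1 (L.tri ![x, y, z]) p + contract₃ (ρ.vf x) (ρ.vf y) (ρ.vf z) ϖ p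
        = -(μ.2.2 ![⁅y, z⁆, x] p) - -(μ.2.2 ![⁅x, z⁆, y] p) + -(μ.2.2 ![⁅x, y⁆, z] p) := h
    rw [contract₃_apply] at h'
    have hR : (omega3 (𝔥 := 𝔥) ρ p).2 ![x, y, z] = ϖ.1 p ![ρ.vf x p, ρ.vf y p, ρ.vf z p] := by
      change ϖ.1 p _ = ϖ.1 p _
      congr 1
      ext i
      fin_cases i <;> rfl
    rw [hR]
    change (-(μ.2.2 ![⁅x, y⁆, z] p) + μ.2.2 ![⁅x, z⁆, y] p - μ.2.2 ![⁅y, z⁆, x] p)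
      - μ.2.1 (L.tri ![x, y, z]) p = _
    linarith

theorem IsGammaTwo.unique [PreconnectedSpace M] {p : M} {γ₁ : 𝔤 →ₗ[ℝ] HamForm ϖ}
    {γ₂ γ₂' : 𝔤 [⋀^Fin 2]→ₗ[ℝ] Fun E M} (h : IsGammaTwo ρ p γ₁ γ₂) (h' : IsGammaTwo ρ p γ₁ γ₂') :
    γ₂ = γ₂' :=
  alternatingMap_ext_two fun x y => eq_of_dFun_eq (p := p)
    ((h x y).1.symm.trans (h' x y).1) ((h x y).2.trans (h' x y).2.symm)

/-- A moment map and `γ₁` lift the same action, so they differ on `𝔤` by a linear family of closed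
forms, which has primitives. -/
theorem IsMomentMap.exists_primitive_sub [PreconnectedSpace M] (hH1 : Subsingleton (DeRhamH1 E M))
    (p : M) {γ₁ : 𝔤 →ₗ[ℝ] HamForm ϖ} (hγ₁ : ∀ x, IsHamVF ϖ (γ₁ x) (ρ.vf x)) {μ : C2 E M 𝔤 𝔥}
    (hμ : IsMomentMap L ρ μ) :
    ∃ β : 𝔤 →ₗ[ℝ] Fun E M, (∀ x, dFun E M (β x) = μ.1 x - γ₁ x) ∧ ∀ x, β x p = 0 := by
  obtain ⟨f₁, hf₁, -, hham⟩ := hμ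
  refine exists_linear_primitive hH1 p (μ.1 - (HamForm ϖ).subtype ∘ₗ γ₁) fun x => ?_
  change d E M 1 (μ.1 x - γ₁ x) = 0
  rw [map_sub, ← hf₁ x, hham x, hγ₁ x, sub_self]

theorem IsMomentMap.dFun_snd (hϖ : IsTwoPlectic ϖ) {μ : C2 E M 𝔤 𝔥} (hμ : IsMomentMap L ρ μ)
    (x y : 𝔤) :
    dFun E M (μ.2.2 ![x, y]) = μ.1 ⁅x, y⁆ - contract₂ (ρ.vf x) (ρ.vf y) ϖ := by
  obtain ⟨f₁, hf₁, hmor, hham⟩ := hμ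
  rw [← hf₁]
  exact ((isLInftyMorphism_iff hϖ hham _ _).1 hmor).2.1 x y

theorem exists_isGammaTwo (hϖ : IsTwoPlectic ϖ) {p : M} {γ₁ : 𝔤 →ₗ[ℝ] HamForm ϖ}
    {μ : C2 E M 𝔤 𝔥} (hμ : IsMomentMap L ρ μ) {β : 𝔤 →ₗ[ℝ] Fun E M}
    (hβ : ∀ x, dFun E M (β x) = μ.1 x - γ₁ x) (hβp : ∀ x, β x p = 0) :
    ∃ γ₂, IsGammaTwo ρ p γ₁ γ₂ := by
  refine ⟨μ.2.2 + dLie1 β -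
    (Algebra.linearMap ℝ (Fun E M) ∘ₗ evalFun E M p).compAlternatingMap μ.2.2, fun x y => ⟨?_, ?_⟩⟩
  · change _ = dFun E M (μ.2.2 ![x, y] + -β ⁅x, y⁆ - algebraMap ℝ (Fun E M) (μ.2.2 ![x, y] p))
    rw [map_sub, map_add, map_neg, dFun_algebraMap, hμ.dFun_snd hϖ, hβ]
    abel
  · change μ.2.2 ![x, y] p + -(β ⁅x, y⁆ p) - μ.2.2 ![x, y] p = 0
    rw [hβp]
    ring

/-- The functions `μ(h)` are closed, hence constant, so evaluating at `p` loses nothing. -/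
theorem phi_evalC2_fst_eq [PreconnectedSpace M] {p : M} {γ₁ : 𝔤 →ₗ[ℝ] HamForm ϖ}
    {γ₂ : 𝔤 [⋀^Fin 2]→ₗ[ℝ] Fun E M} {μ : C2 E M 𝔤 𝔥} (hμ : IsMomentMap L ρ μ) :
    (phi γ₁ γ₂ (evalC2 p μ)).2.1 = μ.2.1 := by
  obtain ⟨f₁, -, hmor, -⟩ := hμ
  ext1 h
  refine eq_of_dFun_eq (p := p) ?_ rfl
  rw [hmor.unary h]
  exact dFun_algebraMap _

/-- The binary components of `μ` and `φ^{r(μ)}` differ by the coboundary of `β`. -/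
theorem phi_evalC2_snd_apply [PreconnectedSpace M] (hϖ : IsTwoPlectic ϖ) {p : M}
    {γ₁ : 𝔤 →ₗ[ℝ] HamForm ϖ} {γ₂ : 𝔤 [⋀^Fin 2]→ₗ[ℝ] Fun E M} (hγ₂ : IsGammaTwo ρ p γ₁ γ₂)
    {μ : C2 E M 𝔤 𝔥} (hμ : IsMomentMap L ρ μ) {β : 𝔤 →ₗ[ℝ] Fun E M}
    (hβ : ∀ x, dFun E M (β x) = μ.1 x - γ₁ x) (hβp : ∀ x, β x p = 0) (x y : 𝔤) :
    (phi γ₁ γ₂ (evalC2 p μ)).2.2 ![x, y] = μ.2.2 ![x, y] - β ⁅x, y⁆ := by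
  change algebraMap ℝ (Fun E M) (μ.2.2 ![x, y] p) + γ₂ ![x, y] = _
  refine eq_of_dFun_eq (p := p) ?_ ?_
  · rw [map_add, map_sub, dFun_algebraMap, ← (hγ₂ x y).1, hμ.dFun_snd hϖ, hβ]
    abel
  · change μ.2.2 ![x, y] p + γ₂ ![x, y] p = μ.2.2 ![x, y] p - β ⁅x, y⁆ p
    rw [hβp, (hγ₂ x y).2, add_zero, sub_zero]

theorem innerEquivalent_phi_evalC2 [PreconnectedSpace M] (hϖ : IsTwoPlectic ϖ) {p : M}
    {γ₁ : 𝔤 →ₗ[ℝ] HamForm ϖ} (hγ₁ : ∀ x, IsHamVF ϖ (γ₁ x) (ρ.vf x))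
    {γ₂ : 𝔤 [⋀^Fin 2]→ₗ[ℝ] Fun E M} (hγ₂ : IsGammaTwo ρ p γ₁ γ₂)
    {μ : C2 E M 𝔤 𝔥} (hμ : IsMomentMap L ρ μ) {β : 𝔤 →ₗ[ℝ] Fun E M}
    (hβ : ∀ x, dFun E M (β x) = μ.1 x - γ₁ x) (hβp : ∀ x, β x p = 0) :
    InnerEquivalent L ρ μ (phi γ₁ γ₂ (evalC2 p μ)) := by
  have hfst := phi_evalC2_fst_eq (p := p) (γ₁ := γ₁) (γ₂ := γ₂) hμ
  have hsnd := phi_evalC2_snd_apply hϖ hγ₂ hμ hβ hβp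
  refine ⟨hμ, ⟨γ₁, fun x => rfl, (isLInftyMorphism_iff hϖ hγ₁ _ _).2 ?_, hγ₁⟩, -β, ?_⟩
  · obtain ⟨f₁, hf₁, hmor, hham⟩ := id hμ
    obtain ⟨hun, -, hmix, htri⟩ := (isLInftyMorphism_iff hϖ hham _ _).1 hmor
    rw [hfst]
    refine ⟨hun, fun x y => ?_, hmix, fun x y z => ?_⟩
    · rw [hsnd, map_sub, hμ.dFun_snd hϖ, hβ]
      abel
    · have hjac : β ⁅x, ⁅y, z⁆⁆ - β ⁅y, ⁅x, z⁆⁆ + β ⁅z, ⁅x, y⁆⁆ = 0 := by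
        rw [← map_sub, ← map_add, leibniz_lie x y z, ← lie_skew z ⁅x, y⁆]
        simp
      rw [hsnd, hsnd, hsnd, htri, ← sub_zero (_ - _ + _), ← hjac]
      abel
  · refine Prod.ext ?_ (Prod.ext ?_ (alternatingMap_ext_two fun x y => ?_))
    · ext1 x
      change μ.1 x - γ₁ x = -dFun E M (-β x)
      rw [map_neg, neg_neg, hβ]
    · change μ.2.1 - (phi γ₁ γ₂ (evalC2 p μ)).2.1 = 0
      rw [hfst, sub_self]
    · change μ.2.2 ![x, y] - (phi γ₁ γ₂ (evalC2 p μ)).2.2 ![x, y] = - -β ⁅x, y⁆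
      rw [hsnd, neg_neg, sub_sub_cancel]

end Moment

end MomentMap

theorem mainTheorem4
    {E : Type*} [NormedAddCommGroup E] [NormedSpace ℝ E] [FiniteDimensional ℝ E]
    {M : Type*} [TopologicalSpace M] [ChartedSpace E M] [IsManifold 𝓘(ℝ, E) ∞ M]
    [T2Space M] [SecondCountableTopology M] [ConnectedSpace M]
    {𝔤 : Type*} [LieRing 𝔤] [LieAlgebra ℝ 𝔤] [FiniteDimensional ℝ 𝔤]
    {𝔥 : Type*} [AddCommGroup 𝔥] [Module ℝ 𝔥] [FiniteDimensional ℝ 𝔥]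
    (L : MinimalLie2Algebra 𝔤 𝔥)
    (ϖ : Form E M 3) (hϖ : IsTwoPlectic ϖ) (ρ : HamAction 𝔤 ϖ)
    (hH1 : Subsingleton (DeRhamH1 E M)) (p : M)
    (γ₁ : 𝔤 →ₗ[ℝ] HamForm ϖ) (hγ₁ : ∀ x, IsHamVF ϖ (γ₁ x) (ρ.vf x))
    (μ : C2 E M 𝔤 𝔥) (hμ : IsMomentMap L ρ μ) :
    dCE2 L (evalC2 p μ) = omega3 ρ p ∧
      (∃! γ₂, IsGammaTwo ρ p γ₁ γ₂) ∧
      ∀ γ₂, IsGammaTwo ρ p γ₁ γ₂ →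
        InnerEquivalent L ρ μ (phi γ₁ γ₂ (evalC2 p μ)) := by
  obtain ⟨β, hβ, hβp⟩ := hμ.exists_primitive_sub hH1 p hγ₁
  obtain ⟨γ₂, hγ₂⟩ := exists_isGammaTwo hϖ hμ hβ hβp
  exact ⟨hμ.dCE2_evalC2 hϖ p, ⟨γ₂, hγ₂, fun _ h => h.unique hγ₂⟩,
    fun _ h => innerEquivalent_phi_evalC2 hϖ hγ₁ h hμ hβ hβp⟩
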